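/- Let $S\subset\mathbb R^2$ be the $\frac13$-von Koch snowflake, i.e. the von Koch curve over the unit segment $[0,1]\times\{0\}$: the unique nonempty compact set with $S=f_1(S)\cup f_2(S)\cup f_3(S)\cup f_4(S)$, where $f_1,\dots,f_4$ are the orientation-preserving similarities of ratio $\frac13$ which map the segment from $(0,0)$ to $(1,0)$, in order, onto the four consecutive segments of the polygonal line with vertices $(0,0),(\frac13,0),(\frac12,\frac{\sqrt3}{6}),(\frac23,0),(1,0)$. For $A\subset\mathbb R^2$ let $B(A,r)=\{x\in\mathbb R^2:\operatorname{dist}(x,A)\le r\}$ be its closed $r$-neighborhood, and for $E\subset\mathbb R^2$ let $$\Lambda(E,r)=\inf\{\mathcal H^1(\Gamma):\Gamma\subset\mathbb R^2\text{ is a rectifiable curve and }B(\Gamma,r)\supset E\},$$ where a rectifiable curve is the image of a continuous map $[0,1]\to\mathbb R^2$ of finite length (not necessarily injective), and $\mathcal H^1$ is the one-dimensional Hausdorff measure. Then there exists a constant $C>1$ such that $$\frac1C\, r^{\frac{\alpha-1}{\alpha}}\le \Lambda(B(S,r),r)\le C\, r^{\frac{\alpha-1}{\alpha}}\qquad\text{for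 all } 0<r<1,$$ where $\alpha=\log_4 3$. -/

import Mathlib

open Set MeasureTheory

/-- A set `Γ` is a rectifiable curve if it is the image of a continuous map `γ : [0, 1] → X`
of finite length (the total variation of `γ` is its length). -/
def IsRectifiableCurve {X : Type*} [PseudoEMetricSpace X] (Γ : Set X) : Prop :=
  ∃ γ : ℝ → X, ContinuousOn γ (Icc (0 : ℝ) 1) ∧ BoundedVariationOn γ (Icc (0 : ℝ) 1) ∧
    γ '' Icc (0 : ℝ) 1 = Γ

/-- The value `Λ(E, r)` of the maximum distance problem in `ℝⁿ`: the infimum of `ℋ¹(Γ)` over all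
rectifiable curves `Γ` whose closed `r`-neighbourhood contains `E`. -/
noncomputable def maxDistValue {n : ℕ} (E : Set (EuclideanSpace ℝ (Fin n))) (r : ℝ) : ENNReal :=
  sInf {m : ENNReal | ∃ Γ : Set (EuclideanSpace ℝ (Fin n)),
    IsRectifiableCurve Γ ∧ E ⊆ Metric.cthickening r Γ ∧ m = Measure.hausdorffMeasure 1 Γ}

/-- The four orientation preserving similarities of ratio `1/3` that generate the von Koch curve
over the unit segment from `(0, 0)` to `(1, 0)`. They send this segment, in order, to the four
segments of the polygonal line
`(0, 0)`, `(1/3, 0)`, `(1/2, √3/6)`, `(2/3, 0)`, `(1, 0)`. -/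
noncomputable def kochMap (i : Fin 4) (p : EuclideanSpace ℝ (Fin 2)) : EuclideanSpace ℝ (Fin 2) :=
  match i with
  | 0 => !₂[p 0 / 3, p 1 / 3]
  | 1 => !₂[1 / 3 + (p 0 - √3 * p 1) / 6, (√3 * p 0 + p 1) / 6]
  | 2 => !₂[1 / 2 + (p 0 + √3 * p 1) / 6, √3 / 6 + (p 1 - √3 * p 0) / 6]
  | 3 => !₂[2 / 3 + p 0 / 3, p 1 / 3]

/-- `S` is a nonempty compact set that is the union of its four images under the Koch maps. -/
def IsKochInvariant (S : Set (EuclideanSpace ℝ (Fin 2))) : Prop :=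
  IsCompact S ∧ S.Nonempty ∧ S = ⋃ i : Fin 4, kochMap i '' S

/-- The Koch maps are similarities of ratio `1/3`. -/
theorem dist_kochMap (i : Fin 4) (p q : EuclideanSpace ℝ (Fin 2)) :
    dist (kochMap i p) (kochMap i q) = dist p q / 3 := by
  have h3 : √(3 : ℝ) ^ 2 = 3 := Real.sq_sqrt (by norm_num)
  have h9 : (3 : ℝ) = √9 := by
    rw [show (9 : ℝ) = 3 ^ 2 by norm_num, Real.sqrt_sq (by norm_num)]
  rw [EuclideanSpace.dist_eq, EuclideanSpace.dist_eq]
  conv_rhs => rw [h9, ← Real.sqrt_div' _ (by norm_num)]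
  congr 1
  simp only [Fin.sum_univ_two, Real.dist_eq, sq_abs]
  fin_cases i
  · simp [kochMap]; ring
  · simp [kochMap]; linear_combination ((p 0 - q 0) ^ 2 + (p 1 - q 1) ^ 2) / 36 * h3
  · simp [kochMap]; linear_combination ((p 0 - q 0) ^ 2 + (p 1 - q 1) ^ 2) / 36 * h3
  · simp [kochMap]; ring

theorem continuous_kochMap (i : Fin 4) : Continuous (kochMap i) := by
  refine (LipschitzWith.of_dist_le_mul (K := 1) fun p q => ?_).continuous
  rw [dist_kochMap]
  have := dist_nonneg (x := p) (y := q)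
  simp only [NNReal.coe_one, one_mul]
  linarith

theorem IsKochInvariant.subset {S T : Set (EuclideanSpace ℝ (Fin 2))}
    (hS : IsKochInvariant S) (hT : IsKochInvariant T) : S ⊆ T := by
  obtain ⟨hSc, hSn, hSe⟩ := hS
  obtain ⟨hTc, hTn, hTe⟩ := hT
  obtain ⟨x, hx, hmax⟩ := hSc.exists_isMaxOn hSn
    (Metric.continuous_infDist_pt T).continuousOn
  have key : Metric.infDist x T ≤ Metric.infDist x T / 3 := by
    have hx' := hx
    rw [hSe] at hx'
    obtain ⟨i, y, hy, rfl⟩ := mem_iUnion.1 hx'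
    obtain ⟨z, hz, hyz⟩ := hTc.exists_infDist_eq_dist hTn y
    have hz' : kochMap i z ∈ T := by
      rw [hTe]
      exact mem_iUnion.2 ⟨i, z, hz, rfl⟩
    have h1 := Metric.infDist_le_dist_of_mem (x := kochMap i y) hz'
    rw [dist_kochMap, ← hyz] at h1
    have h2 : Metric.infDist y T ≤ Metric.infDist (kochMap i y) T := hmax hy
    linarith
  intro w hw
  have h1 : Metric.infDist w T ≤ Metric.infDist x T := hmax hw
  have h0 := Metric.infDist_nonneg (x := w) (s := T)
  rw [hTc.isClosed.mem_iff_infDist_zero hTn]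
  linarith

theorem exists_isKochInvariant : ∃ S, IsKochInvariant S := by
  set F : Set (EuclideanSpace ℝ (Fin 2)) → Set (EuclideanSpace ℝ (Fin 2)) :=
    fun A => ⋃ i : Fin 4, kochMap i '' A with hF
  have hmono : ∀ {A B}, A ⊆ B → F A ⊆ F B := fun h => iUnion_mono fun i => image_mono h
  obtain ⟨R, hR⟩ : ∃ R : ℝ, ∀ i : Fin 4, dist (kochMap i 0) 0 ≤ R :=
    ⟨∑ i : Fin 4, dist (kochMap i 0) 0, fun i =>
      Finset.single_le_sum (f := fun i : Fin 4 => dist (kochMap i 0) 0)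
        (fun _ _ => dist_nonneg) (Finset.mem_univ i)⟩
  have hR0 : 0 ≤ R := dist_nonneg.trans (hR 0)
  have h00 : kochMap 0 0 = 0 := by
    ext j
    fin_cases j <;> simp [kochMap]
  have hball : F (Metric.closedBall 0 (2 * R)) ⊆ Metric.closedBall 0 (2 * R) := by
    refine iUnion_subset fun i => ?_
    rintro _ ⟨y, hy, rfl⟩
    rw [Metric.mem_closedBall] at hy ⊢
    have h1 := dist_triangle (kochMap i y) (kochMap i 0) 0
    rw [dist_kochMap] at h1
    have h2 := hR i
    linarith
  set U : ℕ → Set (EuclideanSpace ℝ (Fin 2)) := fun n => F^[n] {0} with hU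
  have hUs : ∀ n, U (n + 1) = F (U n) := fun n => Function.iterate_succ_apply' F n {0}
  have h0U : ∀ n, (0 : EuclideanSpace ℝ (Fin 2)) ∈ U n := by
    intro n
    induction n with
    | zero => simp [hU]
    | succ n ih =>
      rw [hUs]
      exact mem_iUnion.2 ⟨0, 0, ih, h00⟩
  have hUb : ∀ n, U n ⊆ Metric.closedBall 0 (2 * R) := by
    intro n
    induction n with
    | zero => simpa [hU] using hR0
    | succ n ih =>
      rw [hUs]
      exact (hmono ih).trans hball
  have hcl : IsCompact (closure (⋃ n, U n)) :=
    (isCompact_closedBall (0 : EuclideanSpace ℝ (Fin 2)) (2 * R)).of_isClosed_subset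
      isClosed_closure (closure_minimal (iUnion_subset hUb) Metric.isClosed_closedBall)
  refine ⟨closure (⋃ n, U n), hcl, ⟨0, subset_closure (mem_iUnion.2 ⟨0, h0U 0⟩)⟩, ?_⟩
  apply Subset.antisymm
  · refine closure_minimal (iUnion_subset fun n => ?_)
      (isCompact_iUnion fun i => hcl.image (continuous_kochMap i)).isClosed
    cases n with
    | zero =>
      intro x hx
      have hx0 : x = 0 := by simpa [hU] using hx
      subst hx0
      exact mem_iUnion.2 ⟨0, 0, subset_closure (mem_iUnion.2 ⟨0, h0U 0⟩), h00⟩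
    | succ n =>
      rw [hUs]
      exact hmono ((subset_iUnion U n).trans subset_closure)
  · refine iUnion_subset fun i => (image_closure_subset_closure_image
      (continuous_kochMap i)).trans (closure_mono ?_)
    rw [image_iUnion]
    refine iUnion_subset fun n => ?_
    refine Subset.trans ?_ (subset_iUnion U (n + 1))
    rw [hUs]
    exact subset_iUnion (fun i : Fin 4 => kochMap i '' U n) i

/-- There is exactly one nonempty compact set invariant under the four Koch maps. -/
theorem existsUnique_isKochInvariant : ∃! S, IsKochInvariant S := by
  obtain ⟨S, hS⟩ := exists_isKochInvariant
  exact ⟨S, hS, fun T hT => Subset.antisymm (hT.subset hS) (hS.subset hT)⟩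

/-- The `1/3`-von Koch snowflake `S` (the von Koch curve over the unit segment): the unique
nonempty compact set in the plane with `S = ⋃ i, kochMap i '' S`. -/
noncomputable def vonKochSnowflake : Set (EuclideanSpace ℝ (Fin 2)) :=
  existsUnique_isKochInvariant.choose

theorem isKochInvariant_vonKochSnowflake : IsKochInvariant vonKochSnowflake :=
  existsUnique_isKochInvariant.choose_spec.1

/-! Choose `n` with `3⁻⁽ⁿ⁺¹⁾ < r ≤ 3⁻ⁿ`. The exponent `(α - 1) / α` turns `3⁻ⁿ` into `(4/3)ⁿ`, so it
is enough to show that the value is comparable to `(4/3)ⁿ`.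

Upper bound (`IsKochInvariant.exists_isLipschitzPath`): one polygonal path from `0` to `(1, 0)`
serves all radii in `[1/3, 1]`. Replacing a path by the concatenation of its four Koch images
divides the radii by `3` and multiplies the length bound by `4/3`.

Lower bound (`IsKochInvariant.exists_separated`, `IsPreconnected.card_mul_le_hausdorffMeasure`): the
snowflake contains `4ᵐ` points at mutual distances at least `3⁻ᵐ/9`. For `m = n - 4` the curve
passes near each of them and, being connected, has length at least `r` in each of `4ᵐ` disjoint
balls. Hence its length is at least `4ᵐ r`. -/

/-! ### Lipschitz paths and their concatenation -/

/-- `Γ` is the image of a `K`-Lipschitz path from `a` to `b` that is parametrized by `[0, 1]`. -/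
def IsLipschitzPath {X : Type*} [PseudoMetricSpace X] (K : ℝ) (a b : X) (Γ : Set X) : Prop :=
  ∃ g : ℝ → X, (∀ s ∈ Icc (0 : ℝ) 1, ∀ t ∈ Icc (0 : ℝ) 1, dist (g s) (g t) ≤ K * |s - t|) ∧
    g 0 = a ∧ g 1 = b ∧ g '' Icc (0 : ℝ) 1 = Γ

namespace IsLipschitzPath

theorem mono {X : Type*} [PseudoMetricSpace X] {K L : ℝ} {a b : X} {Γ : Set X}
    (h : IsLipschitzPath K a b Γ) (hKL : K ≤ L) : IsLipschitzPath L a b Γ := by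
  obtain ⟨g, hg, h⟩ := h
  exact ⟨g, fun s hs t ht => (hg s hs t ht).trans
    (mul_le_mul_of_nonneg_right hKL (abs_nonneg _)), h⟩

theorem image {X Y : Type*} [PseudoMetricSpace X] [PseudoMetricSpace Y] {K : ℝ} {a b : X}
    {Γ : Set X} (h : IsLipschitzPath K a b Γ) {f : X → Y} {c : ℝ} (hc : 0 ≤ c)
    (hf : ∀ x y, dist (f x) (f y) ≤ c * dist x y) :
    IsLipschitzPath (c * K) (f a) (f b) (f '' Γ) := by
  obtain ⟨g, hg, rfl, rfl, rfl⟩ := h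
  refine ⟨f ∘ g, fun s hs t ht => ?_, rfl, rfl, image_comp _ _ _⟩
  rw [mul_assoc]
  exact (hf _ _).trans (mul_le_mul_of_nonneg_left (hg s hs t ht) hc)

/-- Each path is run at double speed on one half of `[0, 1]`. -/
theorem trans {X : Type*} [PseudoMetricSpace X] {K : ℝ} {a b c : X} {Γ Δ : Set X}
    (h₁ : IsLipschitzPath K a b Γ) (h₂ : IsLipschitzPath K b c Δ) :
    IsLipschitzPath (2 * K) a c (Γ ∪ Δ) := by
  obtain ⟨g, hg, rfl, hgb, rfl⟩ := h₁
  obtain ⟨h, hh, hhb, rfl, rfl⟩ := h₂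
  set k : ℝ → X := fun t => if t ≤ 1 / 2 then g (2 * t) else h (2 * t - 1) with hk
  have hle : ∀ t, t ≤ 1 / 2 → k t = g (2 * t) := fun t ht => if_pos ht
  have hge : ∀ t, 1 / 2 ≤ t → k t = h (2 * t - 1) := by
    intro t ht
    rcases ht.eq_or_lt with rfl | ht
    · rw [hle _ le_rfl]
      norm_num [hgb, hhb]
    · exact if_neg (not_le.2 ht)
  have key : ∀ s ∈ Icc (0 : ℝ) 1, ∀ t ∈ Icc (0 : ℝ) 1, s ≤ t →
      dist (k s) (k t) ≤ 2 * K * (t - s) := by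
    rintro s ⟨hs0, hs1⟩ t ⟨ht0, ht1⟩ hst
    have h1 : ∀ s t : ℝ, 0 ≤ s → s ≤ t → t ≤ 1 / 2 → dist (k s) (k t) ≤ 2 * K * (t - s) := by
      intro s t hs hst ht
      rw [hle s (hst.trans ht), hle t ht]
      refine (hg _ ⟨by linarith, by linarith⟩ _ ⟨by linarith, by linarith⟩).trans_eq ?_
      rw [abs_sub_comm, abs_of_nonneg (by linarith)]
      ring
    have h2 : ∀ s t : ℝ, 1 / 2 ≤ s → s ≤ t → t ≤ 1 → dist (k s) (k t) ≤ 2 * K * (t - s) := by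
      intro s t hs hst ht
      rw [hge s hs, hge t (hs.trans hst)]
      refine (hh _ ⟨by linarith, by linarith⟩ _ ⟨by linarith, by linarith⟩).trans_eq ?_
      rw [abs_sub_comm, abs_of_nonneg (by linarith)]
      ring
    rcases le_total t (1 / 2) with ht | ht
    · exact h1 s t hs0 hst ht
    rcases le_total s (1 / 2) with hs | hs
    · refine (dist_triangle _ (k (1 / 2)) _).trans ?_
      linarith [h1 s (1 / 2) hs0 hs le_rfl, h2 (1 / 2) t le_rfl ht ht1]
    · exact h2 s t hs hst ht1
  refine ⟨k, fun s hs t ht => ?_, ?_, ?_, ?_⟩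
  · rcases le_total s t with hst | hst
    · rw [abs_sub_comm, abs_of_nonneg (sub_nonneg.2 hst)]
      exact key s hs t ht hst
    · rw [dist_comm, abs_of_nonneg (sub_nonneg.2 hst)]
      exact key t ht s hs hst
  · rw [hle 0 (by norm_num), mul_zero]
  · rw [hge 1 (by norm_num)]
    norm_num
  · apply Subset.antisymm
    · rintro _ ⟨t, ⟨ht0, ht1⟩, rfl⟩
      rcases le_total t (1 / 2) with ht | ht
      · exact .inl ⟨2 * t, ⟨by linarith, by linarith⟩, (hle t ht).symm⟩
      · exact .inr ⟨2 * t - 1, ⟨by linarith, by linarith⟩, (hge t ht).symm⟩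
    · rintro _ (⟨t, ⟨ht0, ht1⟩, rfl⟩ | ⟨t, ⟨ht0, ht1⟩, rfl⟩)
      · refine ⟨t / 2, ⟨by linarith, by linarith⟩, ?_⟩
        rw [hle _ (by linarith)]
        ring_nf
      · refine ⟨(t + 1) / 2, ⟨by linarith, by linarith⟩, ?_⟩
        rw [hge _ (by linarith)]
        ring_nf

theorem isRectifiableCurve {X : Type*} [PseudoMetricSpace X] {K : ℝ} {a b : X} {Γ : Set X}
    (h : IsLipschitzPath K a b Γ) : IsRectifiableCurve Γ := by
  obtain ⟨g, hg, -, -, rfl⟩ := h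
  have hL : LipschitzOnWith K.toNNReal g (Icc 0 1) :=
    LipschitzOnWith.of_dist_le_mul fun s hs t ht => (hg s hs t ht).trans
      (mul_le_mul_of_nonneg_right (Real.le_coe_toNNReal K) (abs_nonneg _))
  refine ⟨g, hL.continuousOn, ?_, rfl⟩
  simpa using hL.locallyBoundedVariationOn 0 1 (by simp) (by simp)

theorem hausdorffMeasure_le {X : Type*} [MetricSpace X] [MeasurableSpace X] [BorelSpace X]
    {K : ℝ} {a b : X} {Γ : Set X} (h : IsLipschitzPath K a b Γ) :
    Measure.hausdorffMeasure 1 Γ ≤ ENNReal.ofReal K := by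
  obtain ⟨g, hg, -, -, rfl⟩ := h
  have hL : LipschitzOnWith K.toNNReal g (Icc 0 1) :=
    LipschitzOnWith.of_dist_le_mul fun s hs t ht => (hg s hs t ht).trans
      (mul_le_mul_of_nonneg_right (Real.le_coe_toNNReal K) (abs_nonneg _))
  refine (hL.hausdorffMeasure_image_le zero_le_one).trans_eq ?_
  rw [hausdorffMeasure_real, Real.volume_Icc]
  simp [ENNReal.ofReal]

theorem segment {E : Type*} [NormedAddCommGroup E] [NormedSpace ℝ E] (a b : E) :
    IsLipschitzPath (dist a b) a b (segment ℝ a b) := by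
  refine ⟨AffineMap.lineMap a b, fun s _ t _ => ?_, AffineMap.lineMap_apply_zero a b,
    AffineMap.lineMap_apply_one a b, (segment_eq_image_lineMap ℝ a b).symm⟩
  rw [dist_lineMap_lineMap, Real.dist_eq, mul_comm]

end IsLipschitzPath

/-- Every finite set lies on a Lipschitz path with prescribed end points. -/
theorem Set.Finite.exists_isLipschitzPath {E : Type*} [NormedAddCommGroup E] [NormedSpace ℝ E]
    {F : Set E} (hF : F.Finite) (a b : E) :
    ∃ K Γ, IsLipschitzPath K a b Γ ∧ F ⊆ Γ := by
  induction F, hF using Set.Finite.induction_on generalizing a with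
  | empty => exact ⟨_, _, .segment a b, empty_subset _⟩
  | @insert x F _ _ ih =>
    obtain ⟨K, Γ, hΓ, hFΓ⟩ := ih x
    refine ⟨_, _, ((IsLipschitzPath.segment a x).mono (le_max_left _ K)).trans
      (hΓ.mono (le_max_right _ _)), insert_subset ?_ (hFΓ.trans subset_union_right)⟩
    exact .inl (right_mem_segment ℝ a x)

/-! ### Length of connected sets near separated points -/

/-- A preconnected set that meets the center and the complement of a ball has `ℋ¹` measure at
least the radius inside this ball. -/
theorem IsPreconnected.ofReal_le_hausdorffMeasure_inter_ball {X : Type*} [MetricSpace X]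
    [MeasurableSpace X] [BorelSpace X] {Γ : Set X} (hΓ : IsPreconnected Γ) {y z : X}
    (hy : y ∈ Γ) (hz : z ∈ Γ) {ρ : ℝ} (hρ : ρ ≤ dist z y) :
    ENNReal.ofReal ρ ≤ Measure.hausdorffMeasure 1 (Γ ∩ Metric.ball y ρ) := by
  -- By connectedness the distance to `y` takes every value in `[0, ρ)` on `Γ`. This function is
  -- 1-Lipschitz, so it does not increase `ℋ¹`.
  have hsub : Ico 0 ρ ⊆ (fun x => dist x y) '' (Γ ∩ Metric.ball y ρ) := by
    rintro t ⟨ht0, ht⟩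
    obtain ⟨x, hx, rfl⟩ := (hΓ.image (fun x => dist x y) (by fun_prop)).Icc_subset
      ⟨y, hy, dist_self y⟩ ⟨z, hz, rfl⟩ ⟨ht0, ht.le.trans hρ⟩
    exact ⟨x, ⟨hx, ht⟩, rfl⟩
  have h1 : LipschitzWith 1 (fun x : X => dist x y) := LipschitzWith.dist_left y
  have h2 := (h1.lipschitzOnWith (s := Γ ∩ Metric.ball y ρ)).hausdorffMeasure_image_le zero_le_one
  have h3 := (measure_mono (μ := Measure.hausdorffMeasure 1) hsub).trans h2
  rw [hausdorffMeasure_real, Real.volume_Ico] at h3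
  simpa using h3

/-- If the closed `r`-neighbourhood of a connected compact set `Γ` of diameter at least `2 * r`
contains `4 * r`-separated points, then `ℋ¹ Γ` is at least `r` times their number. -/
theorem IsPreconnected.card_mul_le_hausdorffMeasure {X : Type*} [MetricSpace X]
    [MeasurableSpace X] [BorelSpace X] {Γ : Set X} (hΓ : IsPreconnected Γ) (hc : IsCompact Γ)
    {ι : Type*} [Fintype ι] {r : ℝ} {x : ι → X} (hx : ∀ i, ∃ y ∈ Γ, dist (x i) y ≤ r)
    (hsep : ∀ i j, i ≠ j → 4 * r ≤ dist (x i) (x j)) {a b : X} (ha : a ∈ Γ) (hb : b ∈ Γ)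
    (hab : 2 * r ≤ dist a b) :
    (Fintype.card ι : ENNReal) * ENNReal.ofReal r ≤ Measure.hausdorffMeasure 1 Γ := by
  choose y hyΓ hy using hx
  have hball : ∀ i, ENNReal.ofReal r ≤
      Measure.hausdorffMeasure 1 (Γ ∩ Metric.ball (y i) r) := by
    intro i
    -- Since `a` and `b` are `2 * r` apart, one of them is at distance at least `r` from `y i`.
    rcases le_total r (dist a (y i)) with h | h
    · exact hΓ.ofReal_le_hausdorffMeasure_inter_ball (hyΓ i) ha h
    · refine hΓ.ofReal_le_hausdorffMeasure_inter_ball (hyΓ i) hb ?_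
      linarith [dist_triangle_right a b (y i)]
  calc (Fintype.card ι : ENNReal) * ENNReal.ofReal r
      = ∑ _i : ι, ENNReal.ofReal r := by simp
    _ ≤ ∑ i : ι, Measure.hausdorffMeasure 1 (Γ ∩ Metric.ball (y i) r) :=
        Finset.sum_le_sum fun i _ => hball i
    _ = ∑' i : ι, Measure.hausdorffMeasure 1 (Γ ∩ Metric.ball (y i) r) := (tsum_fintype _).symm
    _ ≤ Measure.hausdorffMeasure 1 (⋃ i, Γ ∩ Metric.ball (y i) r) := by
        refine tsum_meas_le_meas_iUnion_of_disjoint _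
          (fun i => hc.isClosed.measurableSet.inter measurableSet_ball) fun i j hij => ?_
        -- Moving both points by at most `r` leaves the centers at least `4 * r - 2 * r` apart.
        refine (Metric.ball_disjoint_ball ?_).mono inter_subset_right inter_subset_right
        have h1 := hsep i j hij
        have h2 := dist_triangle4_right (x i) (x j) (y i) (y j)
        linarith [hy i, hy j]
    _ ≤ Measure.hausdorffMeasure 1 Γ :=
        measure_mono (iUnion_subset fun i => inter_subset_left)

theorem IsRectifiableCurve.isCompact {X : Type*} [PseudoEMetricSpace X] {Γ : Set X}
    (h : IsRectifiableCurve Γ) : IsCompact Γ := by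
  obtain ⟨g, hg, -, rfl⟩ := h
  exact isCompact_Icc.image_of_continuousOn hg

theorem IsRectifiableCurve.isPreconnected {X : Type*} [PseudoEMetricSpace X] {Γ : Set X}
    (h : IsRectifiableCurve Γ) : IsPreconnected Γ := by
  obtain ⟨g, hg, -, rfl⟩ := h
  exact isPreconnected_Icc.image g hg

/-! ### Koch maps: inverses, matching end points, fixed points -/

theorem kochMap_surjective (i : Fin 4) : Function.Surjective (kochMap i) := by
  have h3 : √(3 : ℝ) ^ 2 = 3 := Real.sq_sqrt (by norm_num)
  intro q
  fin_cases i
  · refine ⟨!₂[3 * q 0, 3 * q 1], ?_⟩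
    ext j
    fin_cases j <;> simp [kochMap]
  · refine ⟨!₂[3 / 2 * (q 0 - 1 / 3 + √3 * q 1), 3 / 2 * (q 1 - √3 * (q 0 - 1 / 3))], ?_⟩
    ext j
    fin_cases j <;> simp [kochMap]
    · linear_combination (q 0 - 1 / 3) / 4 * h3
    · linear_combination q 1 / 4 * h3
  · refine ⟨!₂[3 / 2 * (q 0 - 1 / 2 - √3 * (q 1 - √3 / 6)),
      3 / 2 * (q 1 - √3 / 6 + √3 * (q 0 - 1 / 2))], ?_⟩
    ext j
    fin_cases j <;> simp [kochMap]
    · linear_combination (q 0 - 1 / 2) / 4 * h3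
    · linear_combination (q 1 - √3 / 6) / 4 * h3
  · refine ⟨!₂[3 * (q 0 - 2 / 3), 3 * q 1], ?_⟩
    ext j
    fin_cases j <;> simp [kochMap]

theorem kochMap_zero_origin : kochMap 0 0 = 0 := by
  ext j
  fin_cases j <;> simp [kochMap]

theorem kochMap_three_endpoint : kochMap 3 !₂[1, 0] = !₂[1, 0] := by
  ext j
  fin_cases j <;> simp [kochMap]
  norm_num

theorem kochMap_zero_endpoint : kochMap 0 !₂[1, 0] = kochMap 1 0 := by
  ext j
  fin_cases j <;> simp [kochMap]

theorem kochMap_one_endpoint : kochMap 1 !₂[1, 0] = kochMap 2 0 := by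
  ext j
  fin_cases j <;> simp [kochMap]
  norm_num

theorem kochMap_two_endpoint : kochMap 2 !₂[1, 0] = kochMap 3 0 := by
  ext j
  fin_cases j <;> simp [kochMap] <;> ring

theorem IsKochInvariant.kochMap_mem {S : Set (EuclideanSpace ℝ (Fin 2))} (hS : IsKochInvariant S)
    (i : Fin 4) {x : EuclideanSpace ℝ (Fin 2)} (hx : x ∈ S) : kochMap i x ∈ S := by
  rw [hS.2.2]
  exact mem_iUnion.2 ⟨i, x, hx, rfl⟩

/-- The fixed points of the Koch maps belong to the snowflake. -/
theorem IsKochInvariant.mem_of_kochMap_eq {S : Set (EuclideanSpace ℝ (Fin 2))}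
    (hS : IsKochInvariant S) {i : Fin 4} {x : EuclideanSpace ℝ (Fin 2)} (hx : kochMap i x = x) :
    x ∈ S := by
  rw [hS.1.isClosed.mem_iff_infDist_zero hS.2.1]
  obtain ⟨z, hz, hxz⟩ := hS.1.exists_infDist_eq_dist hS.2.1 x
  -- Applying the contraction to `x` and its nearest point `z` shows that the distance from `x` to
  -- `S` is at most a third of itself.
  have h := Metric.infDist_le_dist_of_mem (x := x) (hS.kochMap_mem i hz)
  nth_rw 2 [← hx] at h
  rw [dist_kochMap, ← hxz] at h
  linarith [Metric.infDist_nonneg (x := x) (s := S)]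

theorem IsKochInvariant.origin_mem {S : Set (EuclideanSpace ℝ (Fin 2))}
    (hS : IsKochInvariant S) : 0 ∈ S :=
  hS.mem_of_kochMap_eq kochMap_zero_origin

theorem IsKochInvariant.endpoint_mem {S : Set (EuclideanSpace ℝ (Fin 2))}
    (hS : IsKochInvariant S) : !₂[1, 0] ∈ S :=
  hS.mem_of_kochMap_eq kochMap_three_endpoint

/-! ### Separated points in the snowflake -/

/-- The points of the triangle with vertices `(0, 0)`, `(1, 0)` and `(1/2, √3/6)` whose distance
to its sides is at least `t`. -/
def innerTriangle (t : ℝ) : Set (EuclideanSpace ℝ (Fin 2)) :=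
  {p | t ≤ p 1 ∧ 2 * t ≤ p 0 - √3 * p 1 ∧ 2 * t ≤ 1 - p 0 - √3 * p 1}

/-- The Koch maps send the triangle into itself, and distances to its sides shrink by the factor
`1/3`. -/
theorem kochMap_mem_innerTriangle (i : Fin 4) {t : ℝ} (ht : 0 ≤ t)
    {p : EuclideanSpace ℝ (Fin 2)} (hp : p ∈ innerTriangle t) :
    kochMap i p ∈ innerTriangle (t / 3) := by
  have h3 : √(3 : ℝ) ^ 2 = 3 := Real.sq_sqrt (by norm_num)
  have h0 : 0 < √(3 : ℝ) := by positivity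
  obtain ⟨h1, h2, h4⟩ := hp
  have hy := mul_le_mul_of_nonneg_left h1 h0.le
  have ht' := mul_nonneg h0.le ht
  have e2 := mul_le_mul_of_nonneg_left h2 h0.le
  have e4 := mul_le_mul_of_nonneg_left h4 h0.le
  have hs : 1 ≤ √(3 : ℝ) := by nlinarith
  have hst : t ≤ √3 * t := by nlinarith
  fin_cases i <;> refine ⟨?_, ?_, ?_⟩ <;> simp [kochMap] <;> nlinarith

/-- The Koch maps send points of the inner triangle to different vertical strips. -/
theorem kochMap_separated {i j : Fin 4} (hij : i ≠ j) {t : ℝ} (ht : 0 ≤ t)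
    {p q : EuclideanSpace ℝ (Fin 2)} (hp : p ∈ innerTriangle t) (hq : q ∈ innerTriangle t) :
    2 * t / 3 ≤ dist (kochMap i p) (kochMap j q) := by
  have h3 : √(3 : ℝ) ^ 2 = 3 := Real.sq_sqrt (by norm_num)
  have h0 : 0 < √(3 : ℝ) := by positivity
  wlog hlt : i < j generalizing i j p q
  · rw [dist_comm]
    exact this hij.symm hq hp (lt_of_le_of_ne (not_lt.1 hlt) hij.symm)
  -- Compare first coordinates: the strips are cut at `1/3`, `1/2`, `2/3`, and each image point
  -- keeps distance at least `t / 3` from these cuts.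
  have hd : |kochMap j q 0 - kochMap i p 0| ≤ dist (kochMap i p) (kochMap j q) := by
    rw [dist_comm, dist_eq_norm]
    exact PiLp.norm_apply_le (kochMap j q - kochMap i p) 0
  refine le_trans ?_ ((le_abs_self _).trans hd)
  obtain ⟨p1, p2, p4⟩ := hp
  obtain ⟨q1, q2, q4⟩ := hq
  have hpy := mul_nonneg h0.le (ht.trans p1)
  have hqy := mul_nonneg h0.le (ht.trans q1)
  clear hd
  fin_cases i <;> fin_cases j <;> simp at hlt <;> simp [kochMap] <;> linarith

/-- The snowflake contains `4 ^ n` points whose mutual distances are comparable to `3⁻ⁿ`. -/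
theorem IsKochInvariant.exists_separated {S : Set (EuclideanSpace ℝ (Fin 2))}
    (hS : IsKochInvariant S) (n : ℕ) :
    ∃ (ι : Type) (_ : Fintype ι) (x : ι → EuclideanSpace ℝ (Fin 2)), Fintype.card ι = 4 ^ n ∧
      (∀ i, x i ∈ S ∩ innerTriangle ((1 / 3) ^ n / 18)) ∧
      ∀ i j, i ≠ j → (1 / 3) ^ n / 9 ≤ dist (x i) (x j) := by
  induction n with
  | zero =>
    -- This is the point `(7/18, √3/18)`, an interior point of the triangle.
    refine ⟨Unit, inferInstance, fun _ => kochMap 1 (kochMap 1 0), by simp, fun _ => ⟨?_, ?_⟩,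
      fun i j hij => (hij rfl).elim⟩
    · exact hS.kochMap_mem 1 (hS.kochMap_mem 1 hS.origin_mem)
    · have h3 : √(3 : ℝ) ^ 2 = 3 := Real.sq_sqrt (by norm_num)
      have h0 : 0 < √(3 : ℝ) := by positivity
      refine ⟨?_, ?_, ?_⟩ <;> simp [kochMap] <;> nlinarith
  | succ n ih =>
    obtain ⟨ι, _, x, hcard, hx, hsep⟩ := ih
    have ht : (0 : ℝ) ≤ (1 / 3) ^ n / 18 := by positivity
    refine ⟨Fin 4 × ι, inferInstance, fun k => kochMap k.1 (x k.2), ?_, fun k => ⟨?_, ?_⟩, ?_⟩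
    · rw [Fintype.card_prod, hcard, Fintype.card_fin, pow_succ']
    · exact hS.kochMap_mem _ (hx k.2).1
    · convert kochMap_mem_innerTriangle k.1 ht (hx k.2).2 using 1
      congr 1
      ring
    · rintro ⟨i, k⟩ ⟨j, l⟩ hne
      have e : (1 / 3 : ℝ) ^ (n + 1) / 9 = (1 / 3) ^ n / 9 / 3 := by ring
      by_cases hij : i = j
      · subst hij
        rw [dist_kochMap, e]
        have := hsep k l fun h => hne (by rw [h])
        linarith
      -- The constants `18` and `9` are matched here: `2 * t / 3` with `t = (1/3)ⁿ/18` is exactly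
      -- the required separation.
      · refine le_trans (le_of_eq ?_) (kochMap_separated hij ht (hx k).2 (hx l).2)
        rw [e]
        ring

/-! ### Approximating curves -/

/-- Lipschitz paths with constants growing like `(4 / 3) ^ n` that approximate the closed
`3⁻ⁿ`-neighbourhood of the snowflake. -/
theorem IsKochInvariant.exists_isLipschitzPath {S : Set (EuclideanSpace ℝ (Fin 2))}
    (hS : IsKochInvariant S) :
    ∃ K : ℝ, 0 ≤ K ∧ ∀ n : ℕ, ∃ Γ, IsLipschitzPath (K * (4 / 3) ^ n) 0 !₂[1, 0] Γ ∧
      ∀ s : ℝ, 1 / 3 ≤ s → s ≤ 1 → ∀ z ∈ S, ∀ x, dist x z ≤ s * (1 / 3) ^ n →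
        ∃ y ∈ Γ, dist x y ≤ s * (1 / 3) ^ n := by
  -- Balls of the smallest radius `1/3` covering the largest neighbourhood work for all `s` in
  -- `[1/3, 1]` at once.
  obtain ⟨F, -, hF, hcov⟩ := (hS.1.cthickening (r := 1)).finite_cover_balls
    (e := 1 / 3) (by norm_num)
  obtain ⟨K, Γ₀, hΓ₀, hFΓ₀⟩ := hF.exists_isLipschitzPath 0 !₂[(1 : ℝ), 0]
  refine ⟨max K 0, le_max_right _ _, fun n => ?_⟩
  induction n with
  | zero =>
    refine ⟨Γ₀, hΓ₀.mono (by simp), fun s hs hs1 z hz x hx => ?_⟩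
    rw [pow_zero, mul_one] at hx ⊢
    obtain ⟨y, hy, hxy⟩ := mem_iUnion₂.1
      (hcov (Metric.mem_cthickening_of_dist_le x z 1 S hz (hx.trans hs1)))
    exact ⟨y, hFΓ₀ hy, (Metric.mem_ball.1 hxy).le.trans hs⟩
  | succ n ih =>
    obtain ⟨Γ, hΓ, hcov⟩ := ih
    have him : ∀ i, IsLipschitzPath (1 / 3 * (max K 0 * (4 / 3) ^ n)) (kochMap i 0)
        (kochMap i !₂[1, 0]) (kochMap i '' Γ) := fun i =>
      hΓ.image (by norm_num) fun x y => by rw [dist_kochMap]; linarith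
    have h01 := him 0
    have h12 := him 1
    have h23 := him 2
    have h33 := him 3
    rw [kochMap_zero_origin, kochMap_zero_endpoint] at h01
    rw [kochMap_one_endpoint] at h12
    rw [kochMap_two_endpoint] at h23
    rw [kochMap_three_endpoint] at h33
    refine ⟨_, ((h01.trans h12).trans (h23.trans h33)).mono (le_of_eq (by ring)), ?_⟩
    intro s hs hs1 z hz x hx
    obtain ⟨i, w, hw, rfl⟩ := mem_iUnion.1 (hS.2.2.subset hz)
    -- The point near `kochMap i w` is pulled back to a point near `w`, where the previous path
    -- applies.
    obtain ⟨x, rfl⟩ := kochMap_surjective i x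
    have e : s * (1 / 3 : ℝ) ^ (n + 1) = s * (1 / 3) ^ n / 3 := by ring
    rw [dist_kochMap, e] at hx
    obtain ⟨y, hy, hxy⟩ := hcov s hs hs1 w hw x (by linarith)
    refine ⟨kochMap i y, ?_, by rw [dist_kochMap, e]; linarith⟩
    have hm := mem_image_of_mem (kochMap i) hy
    fin_cases i
    · exact .inl (.inl hm)
    · exact .inl (.inr hm)
    · exact .inr (.inl hm)
    · exact .inr (.inr hm)

/-! ### The exponent and the two bounds -/

theorem one_third_rpow_koch_exponent :
    (1 / 3 : ℝ) ^ ((Real.logb 4 3 - 1) / Real.logb 4 3) = 4 / 3 := by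
  have h3 : Real.log 3 ≠ 0 := (Real.log_pos (by norm_num)).ne'
  have h4 : Real.log 4 ≠ 0 := (Real.log_pos (by norm_num)).ne'
  have h : (Real.logb 4 3 - 1) / Real.logb 4 3 = 1 - Real.logb 3 4 := by
    rw [Real.logb, Real.logb]
    field_simp
  rw [h, one_div, Real.inv_rpow (by norm_num), Real.rpow_sub (by norm_num), Real.rpow_one,
    Real.rpow_logb (by norm_num) (by norm_num) (by norm_num), inv_div]

theorem koch_exponent_nonpos : (Real.logb 4 3 - 1) / Real.logb 4 3 ≤ 0 := by
  refine div_nonpos_of_nonpos_of_nonneg ?_ (Real.logb_nonneg (by norm_num) (by norm_num))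
  rw [sub_nonpos, Real.logb_le_iff_le_rpow (by norm_num) (by norm_num)]
  norm_num

theorem one_third_pow_rpow_koch_exponent (n : ℕ) :
    ((1 / 3 : ℝ) ^ n) ^ ((Real.logb 4 3 - 1) / Real.logb 4 3) = (4 / 3) ^ n := by
  rw [← Real.rpow_natCast, ← Real.rpow_mul (by norm_num), mul_comm, Real.rpow_mul (by norm_num),
    one_third_rpow_koch_exponent, Real.rpow_natCast]

/-- A set whose closed `r`-neighbourhood contains that of the snowflake has two
points at distance at least `1`. -/
theorem exists_one_le_dist_of_cthickening_subset {r : ℝ} (hr : 0 ≤ r)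
    {Γ : Set (EuclideanSpace ℝ (Fin 2))}
    (hcov : ∀ z ∈ vonKochSnowflake, ∀ x, dist x z ≤ r → ∃ y ∈ Γ, dist x y ≤ r) :
    ∃ a ∈ Γ, ∃ b ∈ Γ, 1 ≤ dist a b := by
  have hS := isKochInvariant_vonKochSnowflake
  -- Moving the end points of the unit segment outward by `r` offsets the loss of `2 * r` in passing
  -- to `Γ`, so the bound survives for large `r`.
  obtain ⟨a, ha, hxa⟩ := hcov 0 hS.origin_mem !₂[-r, 0] (by
    simp [EuclideanSpace.norm_eq, Real.sqrt_sq_eq_abs, abs_of_nonneg hr])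
  obtain ⟨b, hb, hxb⟩ := hcov _ hS.endpoint_mem !₂[1 + r, 0] (by
    simp [EuclideanSpace.dist_eq, Real.dist_eq, Real.sqrt_sq_eq_abs, abs_of_nonneg hr])
  have hd : 1 + 2 * r ≤ dist (!₂[-r, 0] : EuclideanSpace ℝ (Fin 2)) !₂[1 + r, 0] := by
    simp only [EuclideanSpace.dist_eq, Real.dist_eq, Fin.sum_univ_two]
    simp [Real.sqrt_sq_eq_abs]
    rw [abs_sub_comm]
    exact le_trans (by linarith) (le_abs_self _)
  refine ⟨a, ha, b, hb, ?_⟩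
  linarith [dist_triangle4 !₂[-r, 0] a b !₂[1 + r, 0], dist_comm b !₂[1 + r, 0]]

theorem maxDistValue_snowflake_lower {n : ℕ} {r : ℝ} (hr0 : 0 < r) (hn : (1 / 3) ^ (n + 1) < r)
    (hn' : r ≤ (1 / 3) ^ n) :
    ENNReal.ofReal (1024⁻¹ * (4 / 3) ^ (n + 1)) ≤
      maxDistValue (Metric.cthickening r vonKochSnowflake) r := by
  have hS := isKochInvariant_vonKochSnowflake
  refine le_sInf ?_
  rintro _ ⟨Γ, hΓ, hsub, rfl⟩
  have hcov : ∀ z ∈ vonKochSnowflake, ∀ x, dist x z ≤ r → ∃ y ∈ Γ, dist x y ≤ r := by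
    intro z hz x hx
    have hx' := hsub (Metric.mem_cthickening_of_dist_le x z r _ hz hx)
    rw [hΓ.isCompact.cthickening_eq_biUnion_closedBall hr0.le] at hx'
    obtain ⟨y, hy, hxy⟩ := mem_iUnion₂.1 hx'
    exact ⟨y, hy, hxy⟩
  obtain ⟨a, ha, b, hb, hab⟩ := exists_one_le_dist_of_cthickening_subset hr0.le hcov
  -- For `n < 4` the diameter bound suffices, as `(4/3)⁴ < 1024`.
  rcases lt_or_ge n 4 with hlt | hge
  · refine le_trans ?_ ((hΓ.isPreconnected.ofReal_le_hausdorffMeasure_inter_ball hb ha hab).trans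
      (measure_mono inter_subset_left))
    apply ENNReal.ofReal_le_ofReal
    interval_cases n <;> norm_num
  · obtain ⟨m, rfl⟩ := Nat.exists_eq_add_of_le' hge
    obtain ⟨ι, _, x, hcard, hx, hsep⟩ := hS.exists_separated m
    -- The shift by `4` gives `4 * r ≤ 4/81 * 3⁻ᵐ ≤ 3⁻ᵐ/9`, the separation needed.
    have e : (1 / 3 : ℝ) ^ (m + 4) = (1 / 3) ^ m / 81 := by ring
    have hm : (1 / 3 : ℝ) ^ m ≤ 1 := pow_le_one₀ (by norm_num) (by norm_num)
    have hm0 : (0 : ℝ) < (1 / 3) ^ m := by positivity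
    rw [e] at hn'
    have key := hΓ.isPreconnected.card_mul_le_hausdorffMeasure hΓ.isCompact
      (fun i => hcov _ (hx i).1 (x i) (by rw [dist_self]; exact hr0.le))
      (fun i j hij => le_trans (by linarith) (hsep i j hij)) ha hb
      (hab.trans' (by linarith))
    refine le_trans ?_ key
    rw [hcard, ← ENNReal.ofReal_natCast, ← ENNReal.ofReal_mul (Nat.cast_nonneg _)]
    apply ENNReal.ofReal_le_ofReal
    push_cast
    -- Here `1024 = 4⁵` is the price of having `4ᵐ` points instead of `4ᵐ⁺⁵`.
    have e2 : (4 / 3 : ℝ) ^ (m + 4 + 1) = 1024 * (4 ^ m * (1 / 3) ^ (m + 4 + 1)) := by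
      rw [div_eq_mul_one_div, mul_pow]
      ring
    rw [e2, inv_mul_cancel_left₀ (by norm_num)]
    exact mul_le_mul_of_nonneg_left hn.le (by positivity)

theorem maxDistValue_snowflake_upper :
    ∃ K : ℝ, 0 ≤ K ∧ ∀ (n : ℕ) (r : ℝ), (1 / 3) ^ (n + 1) < r → r ≤ (1 / 3) ^ n →
      maxDistValue (Metric.cthickening r vonKochSnowflake) r ≤
        ENNReal.ofReal (K * (4 / 3) ^ n) := by
  have hS := isKochInvariant_vonKochSnowflake
  obtain ⟨K, hK, h⟩ := hS.exists_isLipschitzPath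
  refine ⟨K, hK, fun n r hn hn' => ?_⟩
  obtain ⟨Γ, hΓ, hcov⟩ := h n
  have hp : (0 : ℝ) < (1 / 3) ^ n := by positivity
  have hr0 : 0 < r := lt_trans (by positivity) hn
  refine le_trans (sInf_le ?_) hΓ.hausdorffMeasure_le
  refine ⟨Γ, hΓ.isRectifiableCurve, ?_, rfl⟩
  intro x hx
  rw [hS.1.cthickening_eq_biUnion_closedBall hr0.le] at hx
  obtain ⟨z, hz, hxz⟩ := mem_iUnion₂.1 hx
  have e : r / (1 / 3) ^ n * (1 / 3) ^ n = r := div_mul_cancel₀ r hp.ne'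
  obtain ⟨y, hy, hxy⟩ := hcov (r / (1 / 3) ^ n) (by
    rw [le_div_iff₀ hp, ← pow_succ']
    exact hn.le) ((div_le_one hp).2 hn') z hz x (by rw [e]; exact hxz)
  rw [e] at hxy
  exact Metric.mem_cthickening_of_dist_le x y r Γ hy hxy

theorem mainTheorem3 :
    ∃ C : ℝ, 1 < C ∧ ∀ r : ℝ, 0 < r → r < 1 →
      ENNReal.ofReal (C⁻¹ * r ^ ((Real.logb 4 3 - 1) / Real.logb 4 3)) ≤
          maxDistValue (Metric.cthickening r vonKochSnowflake) r ∧
        maxDistValue (Metric.cthickening r vonKochSnowflake) r ≤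
          ENNReal.ofReal (C * r ^ ((Real.logb 4 3 - 1) / Real.logb 4 3)) := by
  obtain ⟨K, hK, hupper⟩ := maxDistValue_snowflake_upper
  refine ⟨1024 + K, by linarith, fun r hr0 hr1 => ?_⟩
  obtain ⟨n, hn, hn'⟩ := exists_nat_pow_near_of_lt_one hr0 hr1.le
    (by norm_num : (0 : ℝ) < 1 / 3) (by norm_num)
  -- The exponent is nonpositive, so the power of `r` lies between `(4/3)ⁿ` and `(4/3)ⁿ⁺¹`.
  have hle := Real.rpow_le_rpow_of_nonpos (by positivity) hn.le koch_exponent_nonpos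
  have hge := Real.rpow_le_rpow_of_nonpos hr0 hn' koch_exponent_nonpos
  rw [one_third_pow_rpow_koch_exponent] at hle hge
  have h0 := Real.rpow_nonneg hr0.le ((Real.logb 4 3 - 1) / Real.logb 4 3)
  constructor
  · refine le_trans (ENNReal.ofReal_le_ofReal ?_) (maxDistValue_snowflake_lower hr0 hn hn')
    exact mul_le_mul (inv_anti₀ (by norm_num) (by linarith)) hle h0 (by norm_num)
  · refine (hupper n r hn hn').trans (ENNReal.ofReal_le_ofReal ?_)
    exact mul_le_mul (by linarith) hge (by positivity) (by linarith)
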